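/- Let $k$ be an uncountable field and let $R$ be an affine (that is, finitely generated as an algebra, associative with $1$, not necessarily commutative) $k$-algebra. Suppose that $R$ is primitive, i.e. $R$ has a faithful simple module (left or right; either one suffices), and that $\operatorname{GKdim} R\leq 1$, where \[\operatorname{GKdim} R=\sup_V\ \limsup_{n\to\infty}\frac{\log \dim_k (k+V+V^2+\cdots+V^n)}{\log n},\] the supremum being taken over all finite-dimensional $k$-subspaces $V$ of $R$. Then $R$ is finite-dimensional over $k$. -/

import Mathlib

/-- The Gelfand-Kirillov dimension of a `k`-algebra `R`, with values in the extended reals: the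
supremum, over all finite-dimensional subspaces `V` of `R`, of
`limsup_{n → ∞} log (dim_k (k + V + V ^ 2 + ⋯ + V ^ n)) / log n`.
The space `k + V + ⋯ + V ^ n` is the `n`-th power of `k + V`, where `1 : Submodule k R` is the
image of `k` in `R`. -/
noncomputable def gkDim (k R : Type*) [Field k] [Ring R] [Algebra k R] : EReal :=
  ⨆ V : {V : Submodule k R // V.FG},
    Filter.limsup
      (fun n : ℕ =>
        ((Real.log (Module.finrank k ((1 ⊔ V.1) ^ n : Submodule k R)) / Real.log n : ℝ) : EReal))
      Filter.atTop

/-- A ring is left primitive if it has a faithful simple left module. (Simple modules are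
quotients of the ring, so modules in the universe of the ring suffice.) -/
def IsLeftPrimitive.{u} (R : Type u) [Ring R] : Prop :=
  ∃ (M : Type u) (_ : AddCommGroup M) (_ : Module R M), IsSimpleModule R M ∧ FaithfulSMul R M

/-- A ring is right primitive if it has a faithful simple right module, that is, a faithful simple
left module over the opposite ring. -/
def IsRightPrimitive (R : Type*) [Ring R] : Prop :=
  IsLeftPrimitive Rᵐᵒᵖ

/-! Let `V` be spanned by finitely many generators. From `gkDim k R ≤ 1` only the bound dim (k +
V)^n < n²/2 for large n is kept. Normal words (those not reducible to shortlex-smaller ones) form a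
basis of `R`, so some length d has at most d of them. By Morse-Hedlund, long normal words are then
periodic away from their ends. This is used twice.

Bergman's gap: a normal word is determined by bounded data, so growth is at most linear. Let M be a
faithful simple module, and D its endomorphism ring, a division ring by Schur. If M is
finite-dimensional over k, so is `R`. Otherwise M grows at least linearly, and by density m vectors
independent over D make `R` grow at least like mn; hence M has finite rank over D. Then a - c is
left invertible for all but finitely many scalars c. Since `R` has countable dimension and k is
uncountable, Amitsur's argument makes every a algebraic.

Algebraicity: a high power of a nonempty word is not normal, while a long normal word contains a
high power of a short one. So normal words have bounded length and `R` is finite-dimensional. -/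

/-! ### Periodicity of words with few factors -/

/-- A two-sided Morse-Hedlund theorem: if a bi-infinite sequence has at most `d` factors of
length `d`, then two equal factors of length `d` propagate to the whole sequence. -/
theorem apply_add_eq_of_ncard_factors_le {α : Type*} [Finite α] (x : ℤ → α) (d : ℕ)
    (h : (Set.range fun t : ℤ => fun s : Fin d => x (t + (s : ℕ))).ncard ≤ d) {i j : ℤ}
    (hij : ∀ s : ℕ, s < d → x (i + s) = x (j + s)) (t : ℤ) : x (i + t) = x (j + t) := by
  classical
  set F : (m : ℕ) → Set (Fin m → α) := fun m =>
    Set.range fun t : ℤ => fun s : Fin m => x (t + (s : ℕ)) with hF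
  have hfin : ∀ m, (F m).Finite := fun m => Set.toFinite _
  -- The factor count starts at 1 in length 0; if it grew at every step below `d`, it would exceed
  -- `d` in length `d`.
  obtain ⟨m, hmd, hm⟩ : ∃ m < d, (F (m + 1)).ncard ≤ (F m).ncard := by
    by_contra! hcon
    have key : ∀ m ≤ d, m + 1 ≤ (F m).ncard := by
      intro m
      induction m with
      | zero =>
        intro _
        exact Nat.succ_le_of_lt ((Set.ncard_pos (hfin 0)).2 (Set.range_nonempty _))
      | succ m ih =>
        intro hmd
        have h1 := ih (by omega)
        have h2 := hcon m (by omega)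
        omega
    have := key d le_rfl
    have h' : (F d).ncard ≤ d := h
    omega
  -- Forgetting the last letter maps `F (m + 1)` onto `F m`, hence bijectively by `hm`: `m` letters
  -- determine the next one. Forgetting the first letter shows likewise that they determine the
  -- previous one.
  have right : ∀ s t : ℤ, (∀ r : ℕ, r < m → x (s + r) = x (t + r)) → x (s + m) = x (t + m) := by
    intro s t hst
    have hinj := Set.inj_on_of_surj_on_of_ncard_le (s := F (m + 1)) (t := F m)
      (fun f _ => fun r => f r.castSucc) (by
        rintro _ ⟨t, rfl⟩
        exact ⟨t, rfl⟩) (by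
        rintro _ ⟨t, rfl⟩
        exact ⟨_, ⟨t, rfl⟩, rfl⟩) hm
    have := congrFun (hinj ⟨s, rfl⟩ ⟨t, rfl⟩ (funext fun r => hst r r.2) (hfin _)) (Fin.last m)
    simpa using this
  have left : ∀ s t : ℤ, (∀ r : ℕ, r < m → x (s + 1 + r) = x (t + 1 + r)) → x s = x t := by
    intro s t hst
    have hinj := Set.inj_on_of_surj_on_of_ncard_le (s := F (m + 1)) (t := F m)
      (fun f _ => fun r => f r.succ) (by
        rintro _ ⟨t, rfl⟩
        exact ⟨t + 1, by ext r; simp; ring_nf⟩) (by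
        rintro _ ⟨t, rfl⟩
        exact ⟨_, ⟨t - 1, rfl⟩, by ext r; simp⟩) hm
    have := congrFun (hinj ⟨s, rfl⟩ ⟨t, rfl⟩ (funext fun r => by
      have := hst r r.2
      simp only [Fin.val_succ, Nat.cast_add, Nat.cast_one]
      convert this using 2 <;> ring) (hfin _)) 0
    simpa using this
  have hpos : ∀ n : ℕ, ∀ r : ℕ, r < m → x (i + n + r) = x (j + n + r) := by
    intro n
    induction n with
    | zero =>
      intro r hr
      simpa using hij r (by omega)
    | succ n ih =>
      intro r hr
      rcases Nat.lt_or_ge (r + 1) m with h1 | h1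
      · have := ih (r + 1) h1
        push_cast at this ⊢
        convert this using 2 <;> ring
      · obtain rfl : m = r + 1 := by omega
        have := right (i + n) (j + n) ih
        push_cast at this ⊢
        convert this using 2 <;> ring
  have hneg : ∀ n : ℕ, ∀ r : ℕ, r < m → x (i - n + r) = x (j - n + r) := by
    intro n
    induction n with
    | zero =>
      intro r hr
      simpa using hij r (by omega)
    | succ n ih =>
      intro r hr
      rcases r with _ | r
      · have := left (i - n - 1) (j - n - 1) fun r hr => by
          convert ih r hr using 2 <;> ring
        push_cast at this ⊢
        convert this using 2 <;> ring
      · have := ih r (by omega)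
        push_cast at this ⊢
        convert this using 2 <;> ring
  obtain ⟨n, rfl | rfl⟩ := t.eq_nat_or_neg
  · rcases Nat.eq_zero_or_pos m with rfl | hm0
    · have := right (i + n) (j + n) (by simp)
      simpa using this
    · simpa using hpos n 0 hm0
  · rcases Nat.eq_zero_or_pos m with rfl | hm0
    · have := right (i - n) (j - n) (by simp)
      simpa [sub_eq_add_neg] using this
    · simpa [sub_eq_add_neg] using hneg n 0 hm0

/-- A long word with at most `d` factors of length `d` is periodic, with a period at most `d`,
away from its two ends. -/
theorem exists_period_of_ncard_factors_le {α : Type*} [Finite α] (z : ℕ → α) {d N : ℕ}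
    (hN : 3 * d ≤ N) (S : Set (Fin d → α)) (hS : S.ncard ≤ d)
    (hz : ∀ t, t + d ≤ N → (fun s : Fin d => z (t + s)) ∈ S) :
    ∃ q, 0 < q ∧ q ≤ d ∧ ∀ t, d ≤ t → t + q + 2 * d ≤ N → z t = z (t + q) := by
  classical
  have pigeon : ∀ a, a + 2 * d ≤ N → ∃ i j, a ≤ i ∧ i < j ∧ j ≤ a + d ∧
      ∀ s < d, z (i + s) = z (j + s) := by
    intro a ha
    have hcard : S.toFinite.toFinset.card < (Finset.Icc a (a + d)).card := by
      rw [← Set.ncard_eq_toFinset_card, Nat.card_Icc]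
      omega
    obtain ⟨i, hi, j, hj, hne, heq⟩ := Finset.exists_ne_map_eq_of_card_lt_of_maps_to hcard
      (f := fun t => fun s : Fin d => z (t + s)) (by
        intro t ht
        simp only [Finset.coe_Icc, Set.mem_Icc] at ht
        simpa using hz t (by omega))
    simp only [Finset.mem_Icc] at hi hj
    rcases lt_or_gt_of_ne hne with h | h
    · exact ⟨i, j, by omega, h, by omega, fun s hs => congrFun heq ⟨s, hs⟩⟩
    · exact ⟨j, i, by omega, h, by omega, fun s hs => (congrFun heq ⟨s, hs⟩).symm⟩
  -- A repeated window is found near each end of the word. Then `f` walks through the positions,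
  -- cycling in `[i, j)` on the far left and in `[i', j')` on the far right. A jump from `j` to `i`,
  -- or from `j'` to `i'`, does not change the next `d` letters, so `z ∘ f` is a bi-infinite
  -- sequence with no new factors of length `d`.
  obtain ⟨i, j, -, hij, hjd, hwin⟩ := pigeon 0 (by omega)
  obtain ⟨i', j', hi', hij', hjd', hwin'⟩ := pigeon (N - 2 * d) (by omega)
  set f : ℤ → ℤ := fun t =>
    if t < i then i + (t - i) % (j - i) else
    if t < j' then t else i' + (t - i') % (j' - i') with hf
  have hq : (0 : ℤ) < j - i := by omega
  have hq' : (0 : ℤ) < j' - i' := by omega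
  have hd : 0 < d := by omega
  have flow : ∀ t : ℤ, t < i → f t = i + (t - i) % (j - i) := fun t h => if_pos h
  have fmid : ∀ t, (i : ℤ) ≤ t → t < j' → f t = t := fun t h h' =>
    (if_neg (not_lt.2 h)).trans (if_pos h')
  have fhigh : ∀ t, (j' : ℤ) ≤ t → f t = i' + (t - i') % (j' - i') := fun t h =>
    (if_neg (not_lt.2 (by omega))).trans (if_neg (not_lt.2 h))
  have hstep : ∀ t, f (t + 1) = f t + 1 ∨ (f t + 1 = j ∧ f (t + 1) = i) ∨
      (f t + 1 = j' ∧ f (t + 1) = i') := by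
    have modstep : ∀ a q : ℤ, 0 < q →
        ((a + 1) % q = a % q + 1 ∨ (a % q + 1 = q ∧ (a + 1) % q = 0)) := by
      intro a q hq
      have h1 := Int.emod_nonneg a hq.ne'
      have h2 := Int.emod_lt_of_pos a hq
      have h3 : (a + 1) % q = (a % q + 1) % q := by simp
      rcases lt_or_ge (a % q + 1) q with h | h
      · left
        rw [h3, Int.emod_eq_of_lt (by omega) h]
      · right
        have : a % q + 1 = q := by omega
        exact ⟨this, by rw [h3, this, Int.emod_self]⟩
    intro t
    have e : t + 1 - i = (t - i) + 1 := by ring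
    have e' : t + 1 - i' = (t - i') + 1 := by ring
    rcases lt_or_ge t i with h1 | h1
    · rcases lt_or_ge (t + 1) i with h2 | h2
      · rw [flow t h1, flow _ h2, e]
        rcases modstep (t - i) _ hq with h | h <;> omega
      · rw [flow t h1, fmid _ h2 (by omega)]
        rcases modstep (t - i) _ hq with h | h
        · rw [show t - i + 1 = 0 by omega, Int.zero_emod] at h
          have := Int.emod_nonneg (t - i) hq.ne'
          omega
        · omega
    · rcases lt_or_ge t j' with h2 | h2
      · rcases lt_or_ge (t + 1) j' with h3 | h3
        · rw [fmid t h1 h2, fmid _ (by omega) h3]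
          left; rfl
        · rw [fmid t h1 h2, fhigh _ h3, show t + 1 - i' = j' - i' by omega, Int.emod_self]
          omega
      · rw [fhigh t h2, fhigh _ (by omega), e']
        rcases modstep (t - i') _ hq' with h | h <;> omega
  have hfpos : ∀ t, 0 ≤ f t ∧ f t + d ≤ N := by
    intro t
    simp only [hf]
    have h1 := Int.emod_nonneg (t - i) hq.ne'
    have h2 := Int.emod_lt_of_pos (t - i) hq
    have h3 := Int.emod_nonneg (t - i') hq'.ne'
    have h4 := Int.emod_lt_of_pos (t - i') hq'
    split_ifs <;> omega
  have hwindow : ∀ s : ℕ, s < d → ∀ t, z (f (t + s)).toNat = z ((f t).toNat + s) := by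
    intro s
    induction s with
    | zero => simp
    | succ s ih =>
      intro hs t
      have h1 := ih (by omega) (t + 1)
      have h2 : t + ((s + 1 : ℕ) : ℤ) = t + 1 + s := by push_cast; ring
      rw [h2, h1]
      have := hfpos t
      rcases hstep t with h | ⟨h, h'⟩ | ⟨h, h'⟩
      · rw [h]
        congr 1
        omega
      · rw [h', show (f t).toNat + (s + 1) = j + s by omega, ← hwin s (by omega)]
        simp
      · rw [h', show (f t).toNat + (s + 1) = j' + s by omega, ← hwin' s (by omega)]
        simp
  have hcard : (Set.range fun t : ℤ => fun s : Fin d => z (f (t + (s : ℕ))).toNat).ncard ≤ d := by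
    refine (Set.ncard_le_ncard ?_ S.toFinite).trans hS
    rintro _ ⟨t, rfl⟩
    have := hfpos t
    have h := hz (f t).toNat (by omega)
    convert h using 1
    ext s
    exact hwindow s s.2 t
  have hper := apply_add_eq_of_ncard_factors_le (fun t => z (f t).toNat) d hcard (i := i) (j := j)
    (fun s hs => by
      rw [hwindow s hs, hwindow s hs, fmid i le_rfl (by omega), fmid j (by omega) (by omega)]
      simpa using hwin s hs)
  -- The margins `d` and `2 * d` keep `t` and `t + q` inside `[i, j')`, where `f` is the identity.
  refine ⟨j - i, by omega, by omega, fun t ht htN => ?_⟩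
  have := hper (t - i)
  rw [show (i : ℤ) + (t - i) = (t : ℕ) by ring,
    show (j : ℤ) + (t - i) = ((t + (j - i) : ℕ) : ℤ) by push_cast [hij.le]; ring] at this
  rwa [fmid t (by omega) (by omega), fmid _ (by omega) (by omega), Int.toNat_natCast,
    Int.toNat_natCast] at this

/-! ### Normal words, Bergman's gap and powers of words -/

section NormalWords

variable (k : Type*) {R α : Type*} [Field k] [Ring R] [Algebra k R] [LinearOrder α]

/-- A word in the elements `x a` of an algebra is normal if its value is not a linear combination
of the values of the words that precede it in the shortlex order. -/
def IsNormalWord (x : α → R) (w : List α) : Prop :=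
  (w.map x).prod ∉
    Submodule.span k ((fun u : List α => (u.map x).prod) '' {u | List.Shortlex (· < ·) u w})

variable {k}

theorem List.Shortlex.append_append {u w : List α} (h : List.Shortlex (· < ·) u w)
    (l r : List α) : List.Shortlex (· < ·) (l ++ u ++ r) (l ++ w ++ r) := by
  have key : List.Shortlex (· < ·) (u ++ r) (w ++ r) := by
    rcases List.shortlex_def.1 h with h | ⟨h, h'⟩
    · exact .of_length_lt (by simpa using h)
    · refine .of_lex (by simpa using h) ?_
      clear * - h h'
      induction h' with
      | nil => simp at h
      | cons _ ih => exact .cons (ih (by simpa using h))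
      | rel h' => exact .rel h'
  simpa using key.append_left l

theorem List.Shortlex.length_le {u w : List α} (h : List.Shortlex (· < ·) u w) :
    u.length ≤ w.length := by
  rcases List.shortlex_def.1 h with h | h <;> omega

/-- Multiplying an expression of `w` through smaller words by `l` and `r` expresses `l ++ w ++ r`
through smaller words, since shortlex is compatible with concatenation. -/
theorem IsNormalWord.of_append {x : α → R} {l w r : List α}
    (h : IsNormalWord k x (l ++ w ++ r)) : IsNormalWord k x w := by
  intro hw
  apply h
  have := Submodule.mem_map_of_mem
    (f := (LinearMap.mulLeft k (l.map x).prod).comp (LinearMap.mulRight k (r.map x).prod)) hw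
  rw [Submodule.map_span, ← Set.image_comp] at this
  have e : ((l ++ w ++ r).map x).prod = (l.map x).prod * ((w.map x).prod * (r.map x).prod) := by
    simp
  rw [e]
  refine Submodule.span_mono ?_ this
  rintro _ ⟨u, hu, rfl⟩
  exact ⟨l ++ u ++ r, hu.append_append l r, by simp⟩

theorem IsNormalWord.of_infix {x : α → R} {u w : List α} (h : IsNormalWord k x w)
    (hu : u <:+: w) : IsNormalWord k x u := by
  obtain ⟨l, r, rfl⟩ := hu
  exact h.of_append

/-- Replacing non-normal words by smaller ones terminates, as shortlex over a finite alphabet is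
well-founded, and never increases the length. -/
theorem wordProd_mem_span_normal [Finite α] (x : α → R) (w : List α) :
    (w.map x).prod ∈ Submodule.span k ((fun u : List α => (u.map x).prod) ''
      {u | IsNormalWord k x u ∧ u.length ≤ w.length}) := by
  induction w using (List.Shortlex.wf (wellFounded_lt (α := α))).induction with
  | _ w ih =>
  by_cases hw : IsNormalWord k x w
  · exact Submodule.subset_span ⟨w, ⟨hw, le_rfl⟩, rfl⟩
  · refine Submodule.span_le.2 ?_ (not_not.1 hw)
    rintro _ ⟨u, hu, rfl⟩
    refine Submodule.span_mono (Set.image_mono ?_) (ih u hu)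
    exact fun v hv => ⟨hv.1, hv.2.trans hu.length_le⟩

theorem linearIndependent_of_notMem_span_image_Iio {K V ι : Type*} [DivisionRing K]
    [AddCommGroup V] [Module K V] [LinearOrder ι] (v : ι → V)
    (h : ∀ i, v i ∉ Submodule.span K (v '' Set.Iio i)) : LinearIndependent K v := by
  classical
  rw [linearIndependent_iff']
  intro s g hg
  by_contra! hcon
  have hne : (s.filter fun i => g i ≠ 0).Nonempty := by
    obtain ⟨i, hi, hi'⟩ := hcon
    exact ⟨i, Finset.mem_filter.2 ⟨hi, hi'⟩⟩
  set m := (s.filter fun i => g i ≠ 0).max' hne with hm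
  have hmem := Finset.max'_mem _ hne
  rw [← hm, Finset.mem_filter] at hmem
  apply h m
  have hsum : g m • v m = -∑ i ∈ s.erase m, g i • v i := by
    rw [← Finset.add_sum_erase s _ hmem.1] at hg
    exact eq_neg_of_add_eq_zero_left hg
  rw [← Submodule.smul_mem_iff _ hmem.2, hsum]
  refine neg_mem (Submodule.sum_mem _ fun i hi => ?_)
  by_cases hgi : g i = 0
  · simp [hgi]
  · rw [Finset.mem_erase] at hi
    have := Finset.le_max' (s.filter fun i => g i ≠ 0) i (Finset.mem_filter.2 ⟨hi.2, hgi⟩)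
    exact Submodule.smul_mem _ _ (Submodule.subset_span ⟨i, lt_of_le_of_ne this hi.1, rfl⟩)

theorem linearIndependent_normalWords (x : α → R) :
    LinearIndependent k fun w : {w : List α // IsNormalWord k x w} => (w.1.map x).prod := by
  classical
  let r : {w : List α // IsNormalWord k x w} → {w : List α // IsNormalWord k x w} → Prop :=
    fun u w => List.Shortlex (· < ·) u.1 w.1
  have : IsStrictTotalOrder _ r :=
    { trichotomous := fun a b h h' => Subtype.ext
        ((List.Shortlex.trichotomous (r := (· < ·))).trichotomous a.1 b.1 h h')
      irrefl := fun a h => Std.Asymm.asymm _ _ h h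
      trans := fun a b c h h' => by
        have h1 := List.shortlex_def.1 h
        have h2 := List.shortlex_def.1 h'
        refine List.shortlex_def.2 ?_
        rcases h1 with h1 | h1 <;> rcases h2 with h2 | h2
        · left; omega
        · left; omega
        · left; omega
        · exact Or.inr ⟨h1.1.trans h2.1, List.lt_trans h1.2 h2.2⟩ }
  let _ := linearOrderOfSTO r
  refine linearIndependent_of_notMem_span_image_Iio _ fun w hw => w.2 ?_
  refine Submodule.span_mono ?_ hw
  rintro _ ⟨u, hu, rfl⟩
  exact ⟨u.1, hu, rfl⟩

omit [LinearOrder α] in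
theorem one_sup_span_range_pow (x : α → R) (n : ℕ) :
    (1 ⊔ Submodule.span k (Set.range x)) ^ n =
      Submodule.span k ((fun u : List α => (u.map x).prod) '' {u | u.length ≤ n}) := by
  induction n with
  | zero =>
    rw [pow_zero, Submodule.one_eq_span]
    congr 1
    ext y
    simp
  | succ n ih =>
    rw [pow_succ', ih, Submodule.one_eq_span, ← Submodule.span_union, Submodule.span_mul_span]
    congr 1
    ext y
    constructor
    · rintro ⟨a, ha, _, ⟨u, hu, rfl⟩, rfl⟩
      rcases ha with rfl | ⟨a, rfl⟩
      · exact ⟨u, Nat.le_succ_of_le hu, by simp⟩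
      · exact ⟨a :: u, by simpa using hu, by simp⟩
    · rintro ⟨u, hu, rfl⟩
      rcases u with _ | ⟨a, u⟩
      · exact ⟨1, by simp, 1, ⟨[], by simp, by simp⟩, by simp⟩
      · exact ⟨x a, Or.inr ⟨a, rfl⟩, _, ⟨u, by simpa using hu, rfl⟩, by simp⟩

theorem one_sup_span_range_pow_eq_span_normal [Finite α] (x : α → R) (n : ℕ) :
    (1 ⊔ Submodule.span k (Set.range x)) ^ n =
      Submodule.span k ((fun u : List α => (u.map x).prod) ''
        {u | IsNormalWord k x u ∧ u.length ≤ n}) := by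
  rw [one_sup_span_range_pow]
  refine le_antisymm (Submodule.span_le.2 ?_) (Submodule.span_mono (Set.image_mono fun u h => h.2))
  rintro _ ⟨u, hu, rfl⟩
  refine Submodule.span_mono (Set.image_mono ?_) (wordProd_mem_span_normal x u)
  exact fun v hv => ⟨hv.1, hv.2.trans hu⟩

theorem finite_normal_length_le [Finite α] (x : α → R) (n : ℕ) :
    {u : List α | IsNormalWord k x u ∧ u.length ≤ n}.Finite :=
  (List.finite_length_le α n).subset fun _ hu => hu.2

theorem finite_normal_length_eq [Finite α] (x : α → R) (n : ℕ) :
    {u : List α | IsNormalWord k x u ∧ u.length = n}.Finite :=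
  (List.finite_length_eq α n).subset fun _ hu => hu.2

/-- The normal words of length at most `n` give a basis of this space, so growth becomes a count of
words closed under taking factors. -/
theorem finrank_one_sup_span_range_pow [Finite α] (x : α → R) (n : ℕ) :
    Module.finrank k ((1 ⊔ Submodule.span k (Set.range x)) ^ n : Submodule k R) =
      {u : List α | IsNormalWord k x u ∧ u.length ≤ n}.ncard := by
  have := (finite_normal_length_le (k := k) x n).fintype
  have hli := (linearIndependent_normalWords (k := k) x).comp
    (fun u : {u : List α | IsNormalWord k x u ∧ u.length ≤ n} => ⟨u.1, u.2.1⟩)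
    (fun a b h => Subtype.ext (congrArg (·.1) h))
  have h := finrank_span_eq_card hli
  rw [one_sup_span_range_pow_eq_span_normal, Set.image_eq_range]
  rw [← Nat.card_coe_set_eq, Nat.card_eq_fintype_card, ← h]
  rfl

theorem ncard_normal_length_le [Finite α] (x : α → R) (n : ℕ) :
    {u : List α | IsNormalWord k x u ∧ u.length ≤ n}.ncard =
      ∑ m ∈ Finset.range (n + 1), {u : List α | IsNormalWord k x u ∧ u.length = m}.ncard := by
  induction n with
  | zero => simp
  | succ n ih =>
    rw [Finset.sum_range_succ, ← ih, ← Set.ncard_union_eq _ (finite_normal_length_le x n)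
      (finite_normal_length_eq x (n + 1))]
    · congr 1
      ext u
      simp only [Set.mem_ofPred_eq, Set.mem_union, Nat.le_succ_iff]
      tauto
    · rw [Set.disjoint_left]
      rintro u ⟨-, h⟩ ⟨-, h'⟩
      omega

/-- If there are at most `d` normal words of length `d`, then every long normal word is periodic
away from its ends. -/
theorem IsNormalWord.exists_period [Finite α] {x : α → R} {d : ℕ}
    (hd : {u : List α | IsNormalWord k x u ∧ u.length = d}.ncard ≤ d) {w : List α}
    (hw : IsNormalWord k x w) (hN : 3 * d ≤ w.length) :
    ∃ q, 0 < q ∧ q ≤ d ∧ ∀ t, d ≤ t → t + q + 2 * d ≤ w.length → w[t]? = w[t + q]? := by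
  -- A nonempty word supplies the default letter for `getD`, which extends it to a sequence on `ℕ`.
  -- If the word is empty then `d = 0`, and it is itself a normal word of length 0, where none is
  -- allowed.
  rcases w.eq_nil_or_concat with rfl | ⟨w', a, rfl⟩
  · exfalso
    obtain rfl : d = 0 := by simpa using hN
    have := (Set.ncard_eq_zero (finite_normal_length_eq (k := k) x 0)).1 (by omega)
    exact Set.eq_empty_iff_forall_notMem.1 this [] ⟨hw, rfl⟩
  generalize w'.concat a = w at hw hN ⊢
  obtain ⟨q, h0, hqd, hq⟩ := exists_period_of_ncard_factors_le (fun t => w.getD t a) hN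
    ((fun u : List α => fun s : Fin d => u.getD s a) ''
      {u : List α | IsNormalWord k x u ∧ u.length = d})
      ((Set.ncard_image_le (finite_normal_length_eq x d)).trans hd) (by
      intro t ht
      refine ⟨(w.drop t).take d, ⟨hw.of_infix ?_, by simp; omega⟩, ?_⟩
      · exact (List.take_prefix _ _).isInfix.trans (List.drop_suffix _ _).isInfix
      · ext s
        have := s.2
        simp [List.getD_eq_getElem?_getD, List.getElem?_drop])
  refine ⟨q, h0, hqd, fun t h1 h2 => ?_⟩
  have := hq t h1 h2
  rw [List.getD_eq_getElem _ _ (by omega), List.getD_eq_getElem _ _ (by omega)] at this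
  rw [List.getElem?_eq_getElem (by omega), List.getElem?_eq_getElem (by omega), this]

/-- Bergman's gap: if for some `d` there are at most `d` normal words of length `d`, then the
number of normal words of a given length is bounded. -/
theorem exists_ncard_normal_le [Finite α] {x : α → R} {d : ℕ}
    (hd : {u : List α | IsNormalWord k x u ∧ u.length = d}.ncard ≤ d) :
    ∃ C, ∀ N, {u : List α | IsNormalWord k x u ∧ u.length = N}.ncard ≤ C := by
  classical
  -- A long normal word is encoded by a period and its first and last `3 * d` letters, with `none`
  -- past the end; the period recovers the middle from left to right. For short words the first
  -- block suffices.
  refine ⟨Nat.card (Fin (d + 1) × (Fin (3 * d) → Option α) × (Fin (3 * d) → Option α)),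
    fun N => ?_⟩
  rw [← Nat.card_coe_set_eq]
  rcases lt_or_ge N (3 * d) with hN | hN
  · refine Nat.card_le_card_of_injective (fun u => (0, fun i => u.1[(i : ℕ)]?, fun i => none)) ?_
    rintro ⟨u, hu, rfl⟩ ⟨v, hv, hvu⟩ huv
    simp only [Prod.mk.injEq, true_and, and_true] at huv
    refine Subtype.ext (List.ext_getElem? fun i => ?_)
    rcases lt_or_ge i (3 * d) with hi | hi
    · exact congrFun huv ⟨i, hi⟩
    · rw [List.getElem?_eq_none (hN.le.trans hi),
        List.getElem?_eq_none (hvu.trans_le (hN.le.trans hi))]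
  · have hper : ∀ u : {u : List α | IsNormalWord k x u ∧ u.length = N}, ∃ q : Fin (d + 1),
        0 < (q : ℕ) ∧ ∀ t, d ≤ t → t + q + 2 * d ≤ N → u.1[t]? = u.1[t + q]? := by
      rintro ⟨u, hu, rfl⟩
      obtain ⟨q, h0, hqd, hq⟩ := hu.exists_period hd hN
      exact ⟨⟨q, by omega⟩, h0, hq⟩
    choose q hq0 hq using hper
    refine Nat.card_le_card_of_injective
      (fun u => (q u, fun i => u.1[(i : ℕ)]?, fun i => u.1[N - 3 * d + i]?)) ?_
    intro u v huv
    simp only [Prod.mk.injEq] at huv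
    obtain ⟨hquv, hleft, hright⟩ := huv
    refine Subtype.ext (List.ext_getElem? fun i => ?_)
    induction i using Nat.strong_induction_on with
    | _ i ih =>
    rcases lt_or_ge i (3 * d) with hi | hi
    · exact congrFun hleft ⟨i, hi⟩
    · have hqd := (q u).2
      have hqd0 := hq0 u
      rcases lt_or_ge N (i + 2 * d) with hi' | hi'
      · rcases lt_or_ge i N with hi'' | hi''
        · have := congrFun hright ⟨i - (N - 3 * d), by omega⟩
          simpa [show N - 3 * d + (i - (N - 3 * d)) = i by omega] using this
        · rw [List.getElem?_eq_none (by rw [u.2.2]; omega),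
            List.getElem?_eq_none (by rw [v.2.2]; omega)]
      · have h1 := hq u (i - q u) (by omega) (by omega)
        have h2 := hq v (i - q u) (by omega) (by rw [← hquv]; omega)
        rw [← hquv] at h2
        rw [Nat.sub_add_cancel (by omega)] at h1 h2
        rw [← h1, ← h2]
        exact ih _ (by omega)

/-- Subquadratic growth yields a length `d` with at most `d` normal words. -/
theorem exists_ncard_normal_length_eq_le [Finite α] (x : α → R)
    (h : ∀ᶠ n : ℕ in Filter.atTop, 2 * Module.finrank k
      ((1 ⊔ Submodule.span k (Set.range x)) ^ n : Submodule k R) < n ^ 2) :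
    ∃ d, {u : List α | IsNormalWord k x u ∧ u.length = d}.ncard ≤ d := by
  by_contra! hcon
  obtain ⟨n, hn⟩ := h.exists
  rw [finrank_one_sup_span_range_pow, ncard_normal_length_le] at hn
  have h1 : ∑ m ∈ Finset.range (n + 1), m ≤
      ∑ m ∈ Finset.range (n + 1), {u : List α | IsNormalWord k x u ∧ u.length = m}.ncard :=
    Finset.sum_le_sum fun m _ => (hcon m).le
  have h2 := Finset.sum_range_id_mul_two (n + 1)
  simp only [Nat.add_sub_cancel] at h2
  nlinarith

theorem exists_finrank_pow_le_mul [Finite α] {x : α → R} {d : ℕ}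
    (hd : {u : List α | IsNormalWord k x u ∧ u.length = d}.ncard ≤ d) :
    ∃ C, ∀ n, Module.finrank k ((1 ⊔ Submodule.span k (Set.range x)) ^ n : Submodule k R) ≤
      C * (n + 1) := by
  obtain ⟨C, hC⟩ := exists_ncard_normal_le hd
  refine ⟨C, fun n => ?_⟩
  rw [finrank_one_sup_span_range_pow, ncard_normal_length_le]
  exact (Finset.sum_le_card_nsmul _ _ C fun m _ => hC m).trans (by simp [mul_comm])

/-- The powers of a word with algebraic value are eventually not normal. -/
theorem exists_not_isNormalWord_pow {x : α → R} {w : List α} (hw : w ≠ [])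
    (halg : IsAlgebraic k (w.map x).prod) :
    ∃ e, ∀ n, e ≤ n → ¬ IsNormalWord k x (List.replicate n w).flatten := by
  have hprod : ∀ n, ((List.replicate n w).flatten.map x).prod = (w.map x).prod ^ n := by
    intro n
    induction n with
    | zero => simp
    | succ n ih => simp [List.replicate_succ, pow_succ']
  obtain ⟨p, hp, hpa⟩ := isAlgebraic_iff_isIntegral.1 halg
  rw [← Polynomial.aeval_def] at hpa
  -- The threshold is the degree of a monic annihilating polynomial: it writes that power of the
  -- value through lower powers, that is, through shorter words. Higher powers contain this one as a
  -- prefix.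
  refine ⟨p.natDegree, fun n hn hnorm => ?_⟩
  obtain ⟨m, rfl⟩ := Nat.exists_eq_add_of_le hn
  rw [List.replicate_add, List.flatten_append] at hnorm
  have hnorm := IsNormalWord.of_infix hnorm (List.prefix_append _ _).isInfix
  apply hnorm
  rw [hprod]
  rw [Polynomial.aeval_eq_sum_range, Finset.sum_range_succ, hp.coeff_natDegree, one_smul] at hpa
  rw [eq_neg_of_add_eq_zero_right hpa]
  refine neg_mem (Submodule.sum_mem _ fun i hi => Submodule.smul_mem _ _ ?_)
  refine Submodule.subset_span ⟨(List.replicate i w).flatten, .of_length_lt ?_, hprod i⟩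
  simp only [List.length_flatten, List.map_replicate, List.sum_replicate, smul_eq_mul]
  exact Nat.mul_lt_mul_of_pos_right (Finset.mem_range.1 hi) (List.length_pos_iff.2 hw)

omit [LinearOrder α] in
/-- A subword of a periodic word is a power. -/
theorem take_drop_eq_flatten_replicate {w : List α} {a q L : ℕ}
    (h : ∀ t, a ≤ t → t + q < a + L → w[t]? = w[t + q]?) (n : ℕ) (hn : n * q ≤ L) :
    (w.drop a).take (n * q) = (List.replicate n ((w.drop a).take q)).flatten := by
  induction n with
  | zero => simp
  | succ n ih =>
    have hn' : n * q ≤ L := le_trans (Nat.mul_le_mul_right q n.le_succ) hn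
    have hshift : ∀ t s, t + s * q < L → w[a + t]? = w[a + t + s * q]? := by
      intro t s
      induction s with
      | zero => simp
      | succ s ihs =>
        intro hts
        rw [ihs (by linarith [Nat.succ_mul s q]), h _ (by omega) (by linarith [Nat.succ_mul s q])]
        congr 1
        ring
    rw [List.replicate_succ', List.flatten_append, ← ih hn', Nat.succ_mul, List.take_add]
    congr 1
    simp only [List.flatten_cons, List.flatten_nil, List.append_nil]
    refine List.ext_getElem? fun i => ?_
    rw [List.getElem?_take, List.getElem?_take]
    split_ifs with hi
    · rw [List.drop_drop, List.getElem?_drop, List.getElem?_drop,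
        hshift i n (by linarith [Nat.succ_mul n q])]
      congr 1
      ring
    · rfl

/-- In an algebraic algebra with at most `d` normal words of length `d`, the normal words have
bounded length. -/
theorem exists_length_le_of_isAlgebraic [Finite α] {x : α → R} {d : ℕ}
    (hd : {u : List α | IsNormalWord k x u ∧ u.length = d}.ncard ≤ d)
    (halg : ∀ a : R, IsAlgebraic k a) : ∃ B, ∀ w, IsNormalWord k x w → w.length ≤ B := by
  have hex : ∀ w : List α, ∃ e, w ≠ [] →
      ∀ n, e ≤ n → ¬ IsNormalWord k x (List.replicate n w).flatten := by
    intro w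
    by_cases hw : w = []
    · exact ⟨0, fun h => (h hw).elim⟩
    · obtain ⟨e, he⟩ := exists_not_isNormalWord_pow hw (halg _)
      exact ⟨e, fun _ => he⟩
  choose e he using hex
  -- One exponent `E` serves all of the finitely many words of length at most `d`. In a longer word
  -- than claimed, removing ends of length `d` and `2 * d` leaves more than `E * d` letters of
  -- period `q ≤ d`, hence an `E`-th power of a word of length `q`.
  obtain ⟨E, hE⟩ := ((List.finite_length_le α d).image e).bddAbove
  refine ⟨3 * d + E * d, fun w hw => ?_⟩
  by_contra! hlen
  obtain ⟨q, hq0, hqd, hq⟩ := hw.exists_period hd (by omega)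
  have hEq : E * q ≤ E * d := Nat.mul_le_mul_left E hqd
  set v := (w.drop d).take q with hv
  have hvl : v.length = q := by
    rw [hv, List.length_take, List.length_drop]
    omega
  refine he v ?_ E (hE ⟨v, ?_, rfl⟩) ?_
  · rintro h
    rw [h] at hvl
    exact hq0.ne hvl
  · exact hvl.trans_le hqd
  · rw [← take_drop_eq_flatten_replicate (L := E * q) (fun t h1 h2 => hq t h1 (by omega)) E le_rfl]
    exact hw.of_infix ((List.take_prefix _ _).isInfix.trans (List.drop_suffix _ _).isInfix)

end NormalWords

/-! ### Generating families and countable dimension -/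

section Generation

variable {k R α : Type*} [Field k] [Ring R] [Algebra k R]

theorem one_sup_pow_mono (V : Submodule k R) : Monotone fun n : ℕ => (1 ⊔ V) ^ n :=
  fun _ _ h => pow_le_pow_right₀ le_sup_left h

theorem exists_mem_one_sup_span_range_pow {x : α → R} (hx : Algebra.adjoin k (Set.range x) = ⊤)
    (a : R) : ∃ n, a ∈ (1 ⊔ Submodule.span k (Set.range x)) ^ n := by
  have ha : a ∈ Algebra.adjoin k (Set.range x) := hx ▸ Algebra.mem_top
  induction ha using Algebra.adjoin_induction with
  | mem y hy => exact ⟨1, by simpa using Submodule.mem_sup_right (Submodule.subset_span hy)⟩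
  | algebraMap c => exact ⟨0, by simp [Submodule.mem_one]⟩
  | add y z _ _ hy hz =>
    obtain ⟨m, hm⟩ := hy
    obtain ⟨n, hn⟩ := hz
    exact ⟨max m n, add_mem (one_sup_pow_mono _ (le_max_left m n) hm)
      (one_sup_pow_mono _ (le_max_right m n) hn)⟩
  | mul y z _ _ hy hz =>
    obtain ⟨m, hm⟩ := hy
    obtain ⟨n, hn⟩ := hz
    exact ⟨m + n, by rw [pow_add]; exact Submodule.mul_mem_mul hm hn⟩

theorem one_sup_span_range_pow_fg [Finite α] (x : α → R) (n : ℕ) :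
    ((1 ⊔ Submodule.span k (Set.range x)) ^ n).FG := by
  refine Submodule.FG.pow (Submodule.FG.sup ?_ (Submodule.fg_span (Set.finite_range x))) n
  rw [Submodule.one_eq_span]
  exact Submodule.fg_span (Set.finite_singleton 1)

/-- Generation and growth thus agree for an algebra and its opposite, which reduces right
primitivity to left primitivity. -/
theorem map_op_one_sup_span_range_pow (x : α → R) (n : ℕ) :
    ((1 ⊔ Submodule.span k (Set.range x)) ^ n).map
        (MulOpposite.opLinearEquiv k : R ≃ₗ[k] Rᵐᵒᵖ).toLinearMap =
      (1 ⊔ Submodule.span k (Set.range fun a => MulOpposite.op (x a))) ^ n := by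
  rw [Submodule.map_op_pow, Submodule.map_sup, Submodule.map_op_one, Submodule.map_span,
    ← Set.range_comp]
  rfl

theorem rank_le_aleph0_of_exists_mem_pow {x : α → R} [Countable α]
    (hgen : ∀ a, ∃ n, a ∈ (1 ⊔ Submodule.span k (Set.range x)) ^ n) :
    Module.rank k R ≤ Cardinal.aleph0 := by
  have htop : Submodule.span k (Set.range fun u : List α => (u.map x).prod) = ⊤ := by
    refine eq_top_iff.2 fun a _ => ?_
    obtain ⟨n, hn⟩ := hgen a
    rw [one_sup_span_range_pow] at hn
    exact Submodule.span_mono (Set.image_subset_range _ _) hn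
  rw [← rank_top, ← htop]
  exact (rank_span_le _).trans (Cardinal.le_aleph0_iff_set_countable.2 (Set.countable_range _))

/-- An affine algebraic algebra with at most `d` normal words of length `d` is
finite-dimensional. -/
theorem finiteDimensional_of_isAlgebraic [LinearOrder α] [Finite α] {x : α → R} {d : ℕ}
    (hgen : ∀ a, ∃ n, a ∈ (1 ⊔ Submodule.span k (Set.range x)) ^ n)
    (hd : {u : List α | IsNormalWord k x u ∧ u.length = d}.ncard ≤ d)
    (halg : ∀ a : R, IsAlgebraic k a) : FiniteDimensional k R := by
  obtain ⟨B, hB⟩ := exists_length_le_of_isAlgebraic hd halg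
  suffices h : (1 ⊔ Submodule.span k (Set.range x)) ^ B = ⊤ from
    Module.finite_def.2 (h ▸ one_sup_span_range_pow_fg x B)
  refine eq_top_iff.2 fun a _ => ?_
  obtain ⟨n, hn⟩ := hgen a
  rw [one_sup_span_range_pow_eq_span_normal] at hn ⊢
  refine Submodule.span_mono ?_ hn
  rintro _ ⟨u, hu, rfl⟩
  exact ⟨u, ⟨hu.1, hB u hu.1⟩, rfl⟩

end Generation

/-! ### Simple modules: density, finite rank and algebraicity -/

section SimpleModules

variable {k R M α : Type*} [Field k] [Ring R] [Algebra k R] [AddCommGroup M] [Module R M]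
  [Module k M] [IsScalarTower k R M]

theorem finiteDimensional_of_faithfulSMul [FaithfulSMul R M] [FiniteDimensional k M] :
    FiniteDimensional k R := by
  refine Module.Finite.of_injective (Algebra.lsmul k k M : R →ₐ[k] Module.End k M).toLinearMap ?_
  intro a b hab
  exact FaithfulSMul.eq_of_smul_eq_smul fun m : M => LinearMap.congr_fun hab m

/-- The growth of an infinite-dimensional simple module is at least linear. -/
theorem lt_finrank_map_toSpanSingleton [IsSimpleModule R M] (hM : ¬ FiniteDimensional k M)
    {V : Submodule k R} (hfg : ∀ n, ((1 ⊔ V) ^ n).FG) (hgen : ∀ a, ∃ n, a ∈ (1 ⊔ V) ^ n)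
    {m : M} (hm : m ≠ 0) (n : ℕ) :
    n < Module.finrank k
      (((1 ⊔ V) ^ n).map ((LinearMap.toSpanSingleton R M m).restrictScalars k)) := by
  set φ := (LinearMap.toSpanSingleton R M m).restrictScalars k with hφ
  have hφa : ∀ a, φ a = a • m := fun a => rfl
  have hfd : ∀ n, FiniteDimensional k (((1 ⊔ V) ^ n).map φ) := fun n =>
    Module.Finite.iff_fg.2 ((hfg n).map φ)
  have h1 : ∀ n, (1 : R) ∈ (1 ⊔ V) ^ n := fun n =>
    one_sup_pow_mono V (Nat.zero_le n) (Submodule.one_le.1 (pow_zero (1 ⊔ V)).ge)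
  induction n with
  | zero =>
    have : Nontrivial (((1 ⊔ V) ^ 0).map φ) :=
      ⟨⟨⟨m, 1, h1 0, by simp [hφa]⟩, 0, fun h => hm (congrArg Subtype.val h)⟩⟩
    exact Module.finrank_pos
  | succ n ih =>
    refine Nat.lt_of_le_of_lt (Nat.succ_le_of_lt ih) (Submodule.finrank_lt_finrank_of_lt ?_)
    -- If the chain stalls at step `n`, this finite-dimensional subspace is stable under the
    -- generators, hence under `R`; it contains `m`, so by simplicity it is all of `M`.
    refine lt_of_le_of_ne (Submodule.map_mono (one_sup_pow_mono V n.le_succ)) fun heq => hM ?_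
    have hstep : ∀ a ∈ 1 ⊔ V, ∀ u ∈ ((1 ⊔ V) ^ n).map φ, a • u ∈ ((1 ⊔ V) ^ n).map φ := by
      rintro a ha _ ⟨b, hb, rfl⟩
      rw [heq]
      exact ⟨a * b, by rw [pow_succ']; exact Submodule.mul_mem_mul ha hb, by
        simp [hφa, mul_smul]⟩
    have hstable : ∀ j, ∀ a ∈ (1 ⊔ V) ^ j, ∀ u ∈ ((1 ⊔ V) ^ n).map φ,
        a • u ∈ ((1 ⊔ V) ^ n).map φ := by
      intro j
      induction j with
      | zero =>
        intro a ha u hu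
        rw [pow_zero, Submodule.mem_one] at ha
        obtain ⟨c, rfl⟩ := ha
        rw [algebraMap_smul]
        exact Submodule.smul_mem _ _ hu
      | succ j ihj =>
        intro a ha
        rw [pow_succ'] at ha
        induction ha using Submodule.mul_induction_on' with
        | mem_mul_mem a ha b hb =>
          intro u hu
          rw [mul_smul]
          exact hstep a ha _ (ihj b hb u hu)
        | add a _ b _ iha ihb =>
          intro u hu
          rw [add_smul]
          exact add_mem (iha u hu) (ihb u hu)
    suffices h : ((1 ⊔ V) ^ n).map φ = ⊤ from ⟨h ▸ (hfg n).map φ⟩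
    refine eq_top_iff.2 fun u _ => ?_
    obtain ⟨a, rfl⟩ := IsSimpleModule.toSpanSingleton_surjective R hm u
    obtain ⟨j, hj⟩ := hgen a
    exact hstable j a hj m ⟨1, h1 n, by simp [hφa]⟩

/-- Prescribed values on independent vectors extend to an endomorphism of `M` linear over the
division ring `Module.End R M`, and Jacobson density realizes it on the finite set `s`. -/
theorem exists_smul_eq_of_linearIndependent_end [IsSimpleModule R M] (s : Finset M)
    (hs : LinearIndependent (Module.End R M) fun m : s => (m : M)) (f : s → M) :
    ∃ e : R, ∀ m : s, e • (m : M) = f m := by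
  classical
  obtain ⟨g, hg⟩ := LinearMap.exists_extend ((Module.Basis.span hs).constr ℕ f)
  obtain ⟨e, he⟩ := jacobson_density g s
  refine ⟨e, fun m => ?_⟩
  rw [← he m m.2, ← (Module.Basis.span hs).constr_basis ℕ f m, ← hg, LinearMap.comp_apply,
    Submodule.subtype_apply, Module.Basis.span_apply]

/-- By the density theorem, an algebra of linear growth has finite rank on an
infinite-dimensional simple module. -/
theorem card_le_of_linearIndependent_end [IsSimpleModule R M] (hM : ¬ FiniteDimensional k M)
    {V : Submodule k R} (hfg : ∀ n, ((1 ⊔ V) ^ n).FG) (hgen : ∀ a, ∃ n, a ∈ (1 ⊔ V) ^ n) {C : ℕ}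
    (hC : ∀ n, Module.finrank k ((1 ⊔ V) ^ n : Submodule k R) ≤ C * (n + 1)) (s : Finset M)
    (hs : LinearIndependent (Module.End R M) fun m : s => (m : M)) : s.card ≤ C := by
  classical
  have hne : ∀ m : s, (m : M) ≠ 0 := fun m => hs.ne_zero m
  -- The element `e m` fixes `m` and kills the other vectors of `s`.
  choose e he using fun m : s =>
    exists_smul_eq_of_linearIndependent_end s hs fun m' => if m' = m then (m' : M) else 0
  choose g hg using hgen
  obtain ⟨N, hN⟩ : ∃ N, ∀ m, e m ∈ (1 ⊔ V) ^ N := by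
    obtain ⟨N, hN⟩ := (Set.finite_range fun m => g (e m)).bddAbove
    exact ⟨N, fun m => one_sup_pow_mono V (hN ⟨m, rfl⟩) (hg _)⟩
  set φ : M → R →ₗ[k] M := fun m => (LinearMap.toSpanSingleton R M m).restrictScalars k with hφ
  have hφa : ∀ m a, φ m a = a • m := fun m a => rfl
  set Φ : R →ₗ[k] (s → M) := LinearMap.pi fun m => φ m with hΦ
  -- Choosing a coefficient in `(1 ⊔ V) ^ n` for each `e m` independently embeds the product of the
  -- spaces `(1 ⊔ V) ^ n • m`, each of dimension at least `n + 1`, into the image of `(1 ⊔ V) ^ (n +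
  -- N)` in `s → M`.
  have key : ∀ n, s.card * (n + 1) ≤ C * (n + N + 1) := by
    intro n
    have hfd : ∀ m : s, FiniteDimensional k (((1 ⊔ V) ^ n).map (φ m)) := fun m =>
      Module.Finite.iff_fg.2 ((hfg n).map _)
    have hfd' := Module.Finite.iff_fg.2 (hfg (n + N))
    have hfd'' := Module.Finite.iff_fg.2 ((hfg (n + N)).map Φ)
    let Ψ : (∀ m : s, ((1 ⊔ V) ^ n).map (φ m)) →ₗ[k] (s → M) :=
      LinearMap.pi fun m => (((1 ⊔ V) ^ n).map (φ m)).subtype ∘ₗ LinearMap.proj m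
    have hΨ : ∀ v m, Ψ v m = v m := fun v m => rfl
    have hmem : ∀ v, Ψ v ∈ ((1 ⊔ V) ^ (n + N)).map Φ := by
      intro v
      choose a ha hav using fun m => (v m).2
      refine ⟨∑ m, a m * e m, Submodule.sum_mem _ fun m _ => ?_, ?_⟩
      · rw [pow_add]
        exact Submodule.mul_mem_mul (ha m) (hN m)
      · ext m
        rw [hΨ, ← hav, hΦ, LinearMap.pi_apply, hφa, hφa, Finset.sum_smul]
        simp_rw [mul_smul, he]
        simp
    have hinj : Function.Injective (Ψ.codRestrict _ hmem) := by
      intro v w hvw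
      ext m
      exact congrFun (congrArg Subtype.val hvw) m
    have h1 := LinearMap.finrank_le_finrank_of_injective hinj
    rw [Module.finrank_pi_fintype] at h1
    have h2 : s.card * (n + 1) ≤
        ∑ m : s, Module.finrank k (((1 ⊔ V) ^ n).map (φ m)) := by
      have := Finset.card_nsmul_le_sum (Finset.univ : Finset s)
        (fun m => Module.finrank k (((1 ⊔ V) ^ n).map (φ m))) (n + 1)
        fun m _ => lt_finrank_map_toSpanSingleton hM hfg (fun a => ⟨g a, hg a⟩) (hne m) n
      simpa using this
    exact h2.trans (h1.trans ((Submodule.finrank_map_le _ _).trans (hC _)))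
  by_contra! hcon
  -- For `n = C * N` and `s.card ≥ C + 1` the left side of `key` exceeds the right side by at least
  -- 1.
  have h1 := key (C * N)
  have h2 : (C + 1) * (C * N + 1) ≤ s.card * (C * N + 1) := Nat.mul_le_mul_right _ hcon
  nlinarith

theorem finite_end_of_linear_growth [IsSimpleModule R M] (hM : ¬ FiniteDimensional k M)
    {V : Submodule k R} (hfg : ∀ n, ((1 ⊔ V) ^ n).FG) (hgen : ∀ a, ∃ n, a ∈ (1 ⊔ V) ^ n) {C : ℕ}
    (hC : ∀ n, Module.finrank k ((1 ⊔ V) ^ n : Submodule k R) ≤ C * (n + 1)) :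
    Module.Finite (Module.End R M) M := by
  classical
  rw [← Module.rank_lt_aleph0_iff]
  exact (rank_le (card_le_of_linearIndependent_end hM hfg hgen hC)).trans_lt
    Cardinal.natCast_lt_aleph0

/-- If a simple module has finite rank over its endomorphism ring, then `a - c` acts injectively
on it for all but finitely many scalars `c`. -/
theorem finite_setOf_not_injective_smul_sub [IsSimpleModule R M]
    [Module.Finite (Module.End R M) M] (a : R) :
    {c : k | ¬ Function.Injective fun m : M => (a - algebraMap k R c) • m}.Finite := by
  classical
  by_contra hinf
  let c := Set.Infinite.natEmbedding _ hinf
  have hc : Function.Injective fun n => (c n : k) := Subtype.val_injective.comp c.injective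
  have hv : ∀ n, ∃ v : M, v ≠ 0 ∧ a • v = (c n : k) • v := by
    intro n
    have := (c n).2
    rw [Set.mem_ofPred_eq, Function.Injective] at this
    push Not at this
    obtain ⟨u, w, h, hne⟩ := this
    refine ⟨u - w, sub_ne_zero.2 hne, ?_⟩
    rw [← sub_eq_zero, ← smul_sub, sub_smul, algebraMap_smul] at h
    exact sub_eq_zero.1 h
  choose v hv0 hv using hv
  let p : ℕ → Polynomial k := fun n => ∏ j ∈ Finset.range n, (Polynomial.X - Polynomial.C (c j : k))
  have hpv : ∀ (q : Polynomial k) n, Polynomial.aeval a q • v n = q.eval (c n : k) • v n := by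
    intro q n
    induction q using Polynomial.induction_on' with
    | add q r hq hr => simp [add_smul, hq, hr]
    | monomial i b =>
      have : ∀ i : ℕ, a ^ i • v n = (c n : k) ^ i • v n := by
        intro i
        induction i with
        | zero => simp
        | succ i ih =>
          rw [pow_succ, mul_smul, hv, ← algebraMap_smul R, ← mul_smul, ← Algebra.commutes,
            mul_smul, ih, algebraMap_smul, ← mul_smul, pow_succ']
      rw [Polynomial.aeval_monomial, mul_smul, this, algebraMap_smul, Polynomial.eval_monomial,
        mul_smul]
  -- The kernels of the products of the `a - c j` over `j < n` are subspaces over the endomorphism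
  -- ring. They increase strictly, the eigenvector `v n` being new at step `n + 1`, which finite
  -- rank forbids.
  let K : ℕ → Submodule (Module.End R M) M := fun n =>
    LinearMap.ker (Module.toModuleEnd (Module.End R M) (S := R) M (Polynomial.aeval a (p n)))
  have hK : ∀ n m, m ∈ K n ↔ Polynomial.aeval a (p n) • m = 0 := fun n m => Iff.rfl
  have hmono : StrictMono K := by
    refine strictMono_nat_of_lt_succ fun n => lt_of_le_of_ne (fun m hm => ?_) fun heq => ?_
    · rw [hK] at hm ⊢
      simp only [p, Finset.prod_range_succ_comm, map_mul, mul_smul] at hm ⊢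
      rw [hm, smul_zero]
    · have h1 : v n ∈ K (n + 1) := by
        rw [hK, hpv]
        simp [p, Finset.prod_range_succ]
      rw [← heq, hK, hpv, smul_eq_zero_iff_left (hv0 n), Polynomial.eval_prod,
        Finset.prod_eq_zero_iff] at h1
      obtain ⟨j, hj, hj'⟩ := h1
      simp only [Polynomial.eval_sub, Polynomial.eval_X, Polynomial.eval_C, sub_eq_zero] at hj'
      exact (Finset.mem_range.1 hj).ne (hc hj').symm
  exact not_strictMono_of_wellFoundedGT K hmono

/-- An injective operator on a space of finite rank over a division ring is bijective. By density
its inverse is the action of some `b`, and faithfulness gives the identity in `R`. -/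
theorem exists_mul_eq_one_of_injective_smul [IsSimpleModule R M] [FaithfulSMul R M]
    [Module.Finite (Module.End R M) M] (a : R)
    (ha : Function.Injective fun m : M => a • m) : ∃ b, b * a = 1 := by
  classical
  set T := Module.toModuleEnd (Module.End R M) (S := R) M a with hT
  have hbij : Function.Bijective T := ⟨ha, LinearMap.injective_iff_surjective.1 ha⟩
  obtain ⟨b, hb⟩ := Module.Finite.toModuleEnd_moduleEnd_surjective (R := R) (M := M)
    (LinearEquiv.ofBijective T hbij).symm.toLinearMap
  refine ⟨b, FaithfulSMul.eq_of_smul_eq_smul fun m : M => ?_⟩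
  have h1 : b • (a • m) = (LinearEquiv.ofBijective T hbij).symm (T m) := LinearMap.congr_fun hb (T m)
  rw [mul_smul, h1, one_smul]
  exact (LinearEquiv.ofBijective T hbij).symm_apply_apply m

/-- If `a - c` is left invertible for uncountably many scalars `c`, in an algebra of countable
dimension, then `a` is algebraic. -/
theorem isAlgebraic_of_uncountable_mul_sub_eq_one (hrank : Module.rank k R ≤ Cardinal.aleph0)
    (a : R) {s : Set k} (hs : ¬ s.Countable)
    (h : ∀ c ∈ s, ∃ b, b * (a - algebraMap k R c) = 1) : IsAlgebraic k a := by
  classical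
  choose! b hb using h
  -- Amitsur's argument: uncountably many left inverses in countable dimension satisfy a linear
  -- relation. Multiplying it on the right by the product of the `a - c` clears the inverses and
  -- leaves a polynomial relation for `a`.
  have hdep : ¬ LinearIndependent k fun c : s => b c := fun hli => hs <| by
    rw [← Set.countable_coe_iff, ← Cardinal.mk_le_aleph0_iff]
    exact Cardinal.lift_le_aleph0.1
      (hli.cardinal_lift_le_rank.trans (Cardinal.lift_le_aleph0.2 hrank))
  rw [linearIndependent_iff'] at hdep
  push Not at hdep
  obtain ⟨t, g, hg, c, hct, hgc⟩ := hdep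
  let P : Finset s → Polynomial k := fun u => ∏ c ∈ u, (Polynomial.X - Polynomial.C (c : k))
  have hP : ∀ c ∈ t, b c * Polynomial.aeval a (P t) = Polynomial.aeval a (P (t.erase c)) := by
    intro c hc
    simp only [P]
    rw [← Finset.mul_prod_erase t _ hc, map_mul, ← mul_assoc]
    simp [hb c c.2]
  refine ⟨∑ c ∈ t, Polynomial.C (g c) * P (t.erase c), fun h0 => ?_, ?_⟩
  -- The polynomial is nonzero: at `c` only the term of `c` survives, and its value is `g c` times a
  -- product of nonzero differences.
  · have h1 := congrArg (Polynomial.eval (c : k)) h0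
    rw [Polynomial.eval_finsetSum, Finset.sum_eq_single_of_mem c hct] at h1
    · rw [Polynomial.eval_mul, Polynomial.eval_C, Polynomial.eval_zero, mul_eq_zero,
        Polynomial.eval_prod, Finset.prod_eq_zero_iff] at h1
      rcases h1 with h1 | ⟨c', hc', h1⟩
      · exact hgc h1
      · simp only [Polynomial.eval_sub, Polynomial.eval_X, Polynomial.eval_C, sub_eq_zero] at h1
        exact (Finset.mem_erase.1 hc').1 (Subtype.ext h1.symm)
    · intro c' _ hne
      rw [Polynomial.eval_mul, Polynomial.eval_prod,
        Finset.prod_eq_zero (Finset.mem_erase.2 ⟨hne.symm, hct⟩) (by simp), mul_zero]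
  · rw [map_sum]
    calc _ = (∑ c ∈ t, g c • b c) * Polynomial.aeval a (P t) := by
          rw [Finset.sum_mul]
          refine Finset.sum_congr rfl fun c hc => ?_
          rw [smul_mul_assoc, hP c hc, map_mul, Polynomial.aeval_C, Algebra.smul_def]
      _ = 0 := by rw [hg, zero_mul]

/-- If an algebra of countable dimension over an uncountable field has a faithful simple module of
finite rank over its endomorphism ring, then it is algebraic. -/
theorem isAlgebraic_of_finite_end [Uncountable k] [IsSimpleModule R M] [FaithfulSMul R M]
    [Module.Finite (Module.End R M) M] (hrank : Module.rank k R ≤ Cardinal.aleph0) (a : R) :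
    IsAlgebraic k a := by
  refine isAlgebraic_of_uncountable_mul_sub_eq_one hrank a
    (s := {c : k | ¬ Function.Injective fun m : M => (a - algebraMap k R c) • m}ᶜ) (fun h => ?_)
    fun c hc => exists_mul_eq_one_of_injective_smul (M := M) _ (not_not.1 hc)
  have := h.union (finite_setOf_not_injective_smul_sub (M := M) a).countable
  rw [Set.compl_union_self, Set.countable_univ_iff] at this
  exact not_countable this

end SimpleModules

/-! ### From Gelfand-Kirillov dimension to the theorem -/

/-- A left primitive affine algebra of subquadratic growth over an uncountable field is
finite-dimensional. -/
theorem IsLeftPrimitive.finiteDimensional {k R α : Type*} [Field k] [Uncountable k] [Ring R]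
    [Algebra k R] [LinearOrder α] [Finite α] {x : α → R}
    (hgen : ∀ a, ∃ n, a ∈ (1 ⊔ Submodule.span k (Set.range x)) ^ n)
    (hgrowth : ∀ᶠ n : ℕ in Filter.atTop, 2 * Module.finrank k
      ((1 ⊔ Submodule.span k (Set.range x)) ^ n : Submodule k R) < n ^ 2)
    (hprim : IsLeftPrimitive R) : FiniteDimensional k R := by
  obtain ⟨M, _, _, _, _⟩ := hprim
  let _ : Module k M := Module.compHom M (algebraMap k R)
  have : IsScalarTower k R M := ⟨fun c a m => by
    rw [Algebra.smul_def, mul_smul]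
    rfl⟩
  by_cases hM : FiniteDimensional k M
  · exact finiteDimensional_of_faithfulSMul (M := M)
  obtain ⟨d, hd⟩ := exists_ncard_normal_length_eq_le x hgrowth
  obtain ⟨C, hC⟩ := exists_finrank_pow_le_mul hd
  have := finite_end_of_linear_growth hM (one_sup_span_range_pow_fg x) hgen hC
  exact finiteDimensional_of_isAlgebraic hgen hd
    (isAlgebraic_of_finite_end (M := M) (rank_le_aleph0_of_exists_mem_pow hgen))

theorem eventually_finrank_pow_lt_of_gkDim_le_one {k R : Type*} [Field k] [Ring R] [Algebra k R]
    (hgk : gkDim k R ≤ 1) {V : Submodule k R} (hV : V.FG) :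
    ∀ᶠ n : ℕ in Filter.atTop,
      2 * Module.finrank k ((1 ⊔ V) ^ n : Submodule k R) < n ^ 2 := by
  have h1 := (le_iSup (fun V : {V : Submodule k R // V.FG} => Filter.limsup
      (fun n : ℕ => ((Real.log (Module.finrank k ((1 ⊔ V.1) ^ n : Submodule k R)) / Real.log n : ℝ)
        : EReal)) Filter.atTop) ⟨V, hV⟩).trans hgk
  -- Any exponent strictly between 1 and 2 would do. With 3/2 the dimension is eventually below
  -- n^(3/2), and `n ≥ 4` absorbs the factor 2.
  have h2 : (1 : EReal) < ((3 / 2 : ℝ) : EReal) := by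
    exact_mod_cast (by norm_num : (1 : ℝ) < 3 / 2)
  filter_upwards [Filter.eventually_lt_of_limsup_lt (h1.trans_lt h2), Filter.eventually_ge_atTop 4]
    with n hn hn4
  set f := Module.finrank k ((1 ⊔ V) ^ n : Submodule k R)
  rcases Nat.eq_zero_or_pos f with hf | hf
  · rw [hf]
    positivity
  have hlogn : 0 < Real.log n := Real.log_pos (by exact_mod_cast (by omega : 1 < n))
  have h3 : Real.log f < 3 / 2 * Real.log n := (div_lt_iff₀ hlogn).1 (EReal.coe_lt_coe_iff.1 hn)
  have h4 : Real.log ((f : ℝ) ^ 2) < Real.log ((n : ℝ) ^ 3) := by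
    rw [Real.log_pow, Real.log_pow]
    push_cast
    linarith
  have h5 : f ^ 2 < n ^ 3 := by
    exact_mod_cast (Real.log_lt_log_iff (by positivity) (by positivity)).1 h4
  have h6 : (2 * f) ^ 2 < (n ^ 2) ^ 2 := by
    calc (2 * f) ^ 2 = 4 * f ^ 2 := by ring
      _ < 4 * n ^ 3 := by omega
      _ ≤ n * n ^ 3 := Nat.mul_le_mul_right _ hn4
      _ = (n ^ 2) ^ 2 := by ring
  exact lt_of_pow_lt_pow_left₀ 2 (Nat.zero_le _) h6

theorem mainTheorem3 (k : Type*) [Field k] [Uncountable k]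
    (R : Type*) [Ring R] [Algebra k R]
    (hfg : Algebra.FiniteType k R)
    (hprim : IsLeftPrimitive R ∨ IsRightPrimitive R)
    (hgk : gkDim k R ≤ 1) :
    FiniteDimensional k R := by
  obtain ⟨s, hs⟩ := hfg.out
  let x : Fin s.card → R := fun i => s.equivFin.symm i
  have hx : Set.range x = s := by
    rw [show x = Subtype.val ∘ s.equivFin.symm from rfl, Set.range_comp,
      s.equivFin.symm.surjective.range_eq]
    simp
  have hgen := exists_mem_one_sup_span_range_pow (hx ▸ hs)
  have hgrowth := eventually_finrank_pow_lt_of_gkDim_le_one hgk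
    (Submodule.fg_span (Set.finite_range x))
  rcases hprim with hprim | hprim
  · exact hprim.finiteDimensional hgen hgrowth
  · have : FiniteDimensional k Rᵐᵒᵖ := by
      refine IsLeftPrimitive.finiteDimensional (x := fun i => MulOpposite.op (x i)) (fun a => ?_) ?_
        hprim
      · obtain ⟨n, hn⟩ := hgen a.unop
        exact ⟨n, map_op_one_sup_span_range_pow (k := k) x n ▸ ⟨_, hn, rfl⟩⟩
      · filter_upwards [hgrowth] with n hn
        rw [← map_op_one_sup_span_range_pow]
        rwa [LinearEquiv.finrank_map_eq]
    exact Module.Finite.equiv (MulOpposite.opLinearEquiv k : R ≃ₗ[k] Rᵐᵒᵖ).symm
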